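/- Let $\mathbb{B}=\{\mathsf{T},\mathsf{F}\}$. **Instruction sequences.** Let $\mathcal{F}$ be a set of foci that contains the pairwise different foci $\mathsf{in}{:}i$ and $\mathsf{aux}{:}i$ ($i\ge 1$) and $\mathsf{out}$, and let $\mathcal{M}$ be a set of methods that contains $\mathsf{set{:}T}$, $\mathsf{set{:}F}$ and $\mathsf{get}$; basic instructions are the $f.m$ with $f\in\mathcal{F}$, $m\in\mathcal{M}$. The primitive instructions are, for each basic instruction $a$, the plain basic instruction $a$, the positive test $+a$ and the negative test $-a$; for each $l\in\mathbb{N}$, the forward jump $\#l$; and the termination instruction $!$. Let $\mathcal{IS}_{\mathrm{br}}$ be the set of all non-empty finite sequences of primitive instructions in which every plain or test instruction contains a basic instruction of one of the forms $\mathsf{in}{:}i.\mathsf{get}$, $\mathsf{aux}{:}i.\mathsf{get}$, $\mathsf{aux}{:}i.\mathsf{set}{:}b$, $\mathsf{out}.\mathsf{set}{:}b$ ($i\geq 1$, $b\in\mathbb{B}$). A focus names a Boolean register; $\mathsf{set}{:}b$ makes its contents $b$ and replies $b$, and $\mathsf{get}$ replies its contents and changes nothing. Execution starts with the first instruction. After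 $a$ it proceeds with the next instruction; after $+a$ it proceeds with the next instruction if the reply is $\mathsf{T}$ and skips the next instruction if the reply is $\mathsf{F}$; for $-a$ the roles of the replies are reversed; $\#l$ proceeds with the $l$-th next instruction; $!$ terminates. If $l=0$, if there is no instruction to proceed with, or if a register is addressed that is not provided, execution ends without termination and yields no result. An $X\in\mathcal{IS}_{\mathrm{br}}$ *computes* $f:\mathbb{B}^n\to\mathbb{B}$ if there is an $l\in\mathbb{N}$ such that, for all $b_1,\dots,b_n\in\mathbb{B}$, the execution of $X$ with registers $\mathsf{aux}{:}1,\dots,\mathsf{aux}{:}l$ and $\mathsf{out}$ initially containing $\mathsf{F}$ and registers $\mathsf{in}{:}1,\dots,\mathsf{in}{:}n$ initially containing $b_1,\dots,b_n$ terminates with $f(b_1,\dots,b_n)$ in $\mathsf{out}$. A *Boolean function family* is a sequence $(f_n)_{n\in\mathbb{N}}$ with $f_n:\mathbb{B}^n\to\mathbb{B}$, and $\mathrm{PLIS}$ is the class of all Boolean function families $(f_n)_{n\in\mathbb{N}}$ for which there is a polynomial function $h:\mathbb{N}\to\mathbb{N}$ such that for every $n\in\mathbb{N}$ some $X\in\mathcal{IS}_{\mathrm{br}}$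 of length at most $h(n)$ computes $f_n$. **P/poly.** A Boolean circuit with $n$ inputs is a finite directed acyclic graph with exactly $n$ sources, the input vertices, and exactly one sink, the output vertex, whose other vertices than the sources are $\lnot$-gates of fan-in $1$ or $\lor$-gates or $\land$-gates of fan-in $2$; its size is its number of vertices. $\mathrm{P/poly}$ is the class of all functions $f:\mathbb{B}^*\to\mathbb{B}$ for which there is a polynomial function $T:\mathbb{N}\to\mathbb{N}$ such that for every $n\ge 1$ some circuit with $n$ inputs and size at most $T(n)$ computes the restriction of $f$ to $\mathbb{B}^n$. **Theorem.** Identify each Boolean function family $(f_n)_{n\in\mathbb{N}}$ with the unique function $f:\mathbb{B}^*\to\mathbb{B}$ such that $f(w)=f_n(w)$ for all $n\in\mathbb{N}$ and $w\in\mathbb{B}^n$. Then $$\mathrm{PLIS}=\mathrm{P/poly}.$$ -/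

import Mathlib

namespace SinglePass

/-! ### Boolean function families -/

/-- A Boolean function family: an `n`-ary Boolean function for each `n`. -/
abbrev BoolFunFamily : Type := ∀ n : ℕ, (Fin n → Bool) → Bool

/-- The identification of Boolean function families with functions from the finite strings over
the Booleans to the Booleans: the family `f` corresponds to the function whose restriction to the
strings of length `n` is `f n`. -/
def familyEquiv : BoolFunFamily ≃ (List Bool → Bool) where
  toFun f w := f w.length w.get
  invFun g n b := g (List.ofFn b)
  left_inv f := by
    funext n b
    have key : ∀ (m : ℕ) (h : m = n) (c : Fin m → Bool), (∀ i, c i = b (Fin.cast h i)) →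
        f m c = f n b := by
      intro m h c hc
      subst h
      exact congrArg (f m) (funext hc)
    exact key _ (List.length_ofFn) _ (fun i => by simp [Fin.cast])
  right_inv g := by
    funext w
    exact congrArg g (List.ofFn_get w)

/-- The functions from `ℕ` to `ℕ` that are polynomial. -/
def poly : Set (ℕ → ℕ) := {h | ∃ p : Polynomial ℝ, ∀ n : ℕ, (h n : ℝ) = p.eval (n : ℝ)}

/-! ### Foci, methods, services -/

/-- Foci. `inp i` and `aux i` are the names of the `(i+1)`-th input register and the `(i+1)`-th
auxiliary register (the indices start at `0` here), `out` is the name of the output register, and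
there may be arbitrary further foci. -/
inductive Focus (Φ : Type*) where
  | inp (i : ℕ)
  | aux (i : ℕ)
  | out
  | other (x : Φ)

/-- Methods: the three methods of Boolean registers and arbitrary further methods. -/
inductive Meth (M : Type*) where
  | set (b : Bool)
  | get
  | other (m : M)

/-- Replies: true, false, blocked. -/
inductive Reply where
  | val (b : Bool)
  | blocked

/-- Services: the empty service, and Boolean registers with their contents. -/
inductive Service where
  | empty
  | br (b : Bool)

/-- The service that results from processing a method. -/
def Service.derive {M : Type*} (m : Meth M) : Service → Service
  | .empty => .empty
  | .br b =>
    match m with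
    | .set c => .br c
    | .get => .br b
    | .other _ => .empty

/-- The reply that is produced on processing a method. -/
def Service.reply {M : Type*} (m : Meth M) : Service → Reply
  | .empty => .blocked
  | .br b =>
    match m with
    | .set c => .val c
    | .get => .val b
    | .other _ => .blocked

/-- Basic instructions (which are also the basic actions): the basic instruction `f.m` requests
the service named `f` to process the method `m`. -/
structure BasicInstr (Φ M : Type*) where
  focus : Focus Φ
  meth : Meth M

/-! ### Instruction sequences and threads -/

/-- Primitive instructions. -/
inductive Instr (Φ M : Type*) where
  | plain (a : BasicInstr Φ M)
  | ptest (a : BasicInstr Φ M)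
  | ntest (a : BasicInstr Φ M)
  | jump (l : ℕ)
  | halt

/-- Finite threads. Since `x ⊴ tau ⊵ y` and `x ⊴ tau ⊵ x` are identified, the internal action
`tau` has only one continuation. -/
inductive Thread (Φ M : Type*) where
  /-- inaction -/
  | deadEnd
  /-- termination -/
  | terminated
  /-- internal action -/
  | tau (x : Thread Φ M)
  /-- `pcc x a y` performs `a`, and proceeds as `x` on reply true and as `y` on reply false -/
  | pcc (x : Thread Φ M) (a : BasicInstr Φ M) (y : Thread Φ M)

/-- Thread extraction: the behaviour produced by a finite instruction sequence on execution. -/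
def extr {Φ M : Type*} : List (Instr Φ M) → Thread Φ M
  | [] => .deadEnd
  | .plain a :: X => .pcc (extr X) a (extr X)
  | .ptest a :: X => .pcc (extr X) a (extr (.jump 2 :: X))
  | .ntest a :: X => .pcc (extr (.jump 2 :: X)) a (extr X)
  | .jump 0 :: _ => .deadEnd
  | .jump 1 :: X => extr X
  | .jump (_ + 2) :: [] => .deadEnd
  | .jump (l + 2) :: _ :: X => extr (.jump (l + 1) :: X)
  | .halt :: _ => .terminated
termination_by X => 2 * X.length + (match X with | .jump _ :: _ => 0 | _ => 1)
decreasing_by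
  all_goals simp_wf
  all_goals (try split) <;> omega

open Classical in
/-- The use operator: `use f p S` is the thread that results from processing the method of each
basic action with focus `f` that the thread `p` performs by the service `S`. -/
noncomputable def use {Φ M : Type*} (f : Focus Φ) : Thread Φ M → Service → Thread Φ M
  | .terminated, _ => .terminated
  | .deadEnd, _ => .deadEnd
  | .tau x, S => .tau (use f x S)
  | .pcc x a y, S =>
    if a.focus = f then
      match S.reply a.meth with
      | .val true => .tau (use f x (S.derive a.meth))
      | .val false => .tau (use f y (S.derive a.meth))
      | .blocked => .tau .deadEnd
    else .pcc (use f x S) a (use f y S)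

open Classical in
/-- The apply operator: `apply f p S` is the service that results from processing the method of
each basic action with focus `f` that the thread `p` performs by the service `S`. -/
noncomputable def apply {Φ M : Type*} (f : Focus Φ) : Thread Φ M → Service → Service
  | .terminated, S => S
  | .deadEnd, _ => .empty
  | .tau x, S => apply f x S
  | .pcc x a y, S =>
    if a.focus = f then
      match S.reply a.meth with
      | .val true => apply f x (S.derive a.meth)
      | .val false => apply f y (S.derive a.meth)
      | .blocked => .empty
    else .empty

/-! ### Instruction sequences acting on Boolean registers -/

/-- The basic instructions that may occur in instruction sequences acting on Boolean registers:
input registers can be read, auxiliary registers can be read and set, the output register can be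
set. -/
def BasicInstr.IsBr {Φ M : Type*} (a : BasicInstr Φ M) : Prop :=
  (a.meth = .get ∧ ∃ i, a.focus = .inp i ∨ a.focus = .aux i) ∨
  ((∃ b, a.meth = .set b) ∧ ((∃ i, a.focus = .aux i) ∨ a.focus = .out))

/-- The primitive instructions that may occur in instruction sequences acting on Boolean
registers. -/
def Instr.IsBr {Φ M : Type*} : Instr Φ M → Prop
  | .plain a => a.IsBr
  | .ptest a => a.IsBr
  | .ntest a => a.IsBr
  | .jump _ => True
  | .halt => True

/-- The (non-empty, finite) instruction sequences acting on Boolean registers. -/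
def ISbr (Φ M : Type*) : Set (List (Instr Φ M)) := {X | X ≠ [] ∧ ∀ u ∈ X, u.IsBr}

/-- The thread `p` using the first `l` auxiliary registers, each initially containing false. -/
noncomputable def useAux {Φ M : Type*} (p : Thread Φ M) (l : ℕ) : Thread Φ M :=
  (List.range l).foldl (fun q j => use (.aux j) q (.br false)) p

/-- The thread `p` using the first `n` input registers, with initial contents `b`. -/
noncomputable def useInp {Φ M : Type*} (p : Thread Φ M) {n : ℕ} (b : Fin n → Bool) :
    Thread Φ M :=
  (List.finRange n).foldl (fun q (i : Fin n) => use (.inp (i : ℕ)) q (.br (b i))) p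

/-- The instruction sequence `X` computes the `n`-ary Boolean function `f`. -/
def Computes {Φ M : Type*} (X : List (Instr Φ M)) {n : ℕ} (f : (Fin n → Bool) → Bool) : Prop :=
  ∃ l : ℕ, ∀ b : Fin n → Bool,
    apply .out (useInp (useAux (extr X) l) b) (.br false) = .br (f b)

/-- The class of all Boolean function families that can be computed by instruction sequences from
`IS` whose length is bounded by a function from `FN`. -/
def nuc {Φ M : Type*} (IS : Set (List (Instr Φ M))) (FN : Set (ℕ → ℕ)) : Set BoolFunFamily :=
  {f | ∃ h ∈ FN, ∀ n : ℕ, ∃ X ∈ IS, Computes X (f n) ∧ X.length ≤ h n}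

/-- The class of all Boolean function families that can be computed by polynomial-length
instruction sequences acting on Boolean registers. -/
def PLIS (Φ M : Type*) : Set BoolFunFamily := nuc (ISbr Φ M) poly

/-! ### Boolean circuits and P/poly -/

/-- The label of a vertex of a Boolean circuit with `n` inputs, together with the tails of the
edges that enter the vertex. -/
inductive CNode (n : ℕ) (V : Type) where
  | input (i : Fin n)
  | not (u : V)
  | or (u v : V)
  | and (u v : V)

/-- There is an edge from `w` to a vertex with the given label. -/
def CNode.HasPred {n : ℕ} {V : Type} : CNode n V → V → Prop
  | .input _, _ => False
  | .not u, w => w = u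
  | .or u v, w => w = u ∨ w = v
  | .and u v, w => w = u ∨ w = v

/-- Boolean circuits with `n` inputs and a single output: finite directed acyclic graphs with
exactly `n` sources, the input vertices, and exactly one sink, the output vertex, in which all
other vertices than sources are negation gates with fan-in 1 or disjunction gates or conjunction
gates with fan-in 2. -/
structure BoolCircuit (n : ℕ) where
  /-- the number of vertices -/
  size : ℕ
  node : Fin size → CNode n (Fin size)
  acyclic : ∀ v, ¬ Relation.TransGen (fun u w => (node w).HasPred u) v v
  exists_unique_input : ∀ i : Fin n, ∃! v, node v = .input i
  out : Fin size
  sink_iff : ∀ v, (∀ w, ¬ (node w).HasPred v) ↔ v = out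

theorem BoolCircuit.wellFounded {n : ℕ} (C : BoolCircuit n) :
    WellFounded (fun u w => (C.node w).HasPred u) := by
  have : Std.Irrefl (Relation.TransGen fun u w => (C.node w).HasPred u) := ⟨C.acyclic⟩
  have hwf := Finite.wellFounded_of_trans_of_irrefl
    (Relation.TransGen fun u w => (C.node w).HasPred u)
  have hsub : Subrelation (fun u w => (C.node w).HasPred u)
      (Relation.TransGen fun u w => (C.node w).HasPred u) := fun {_ _} h => .single h
  exact hsub.wf hwf

/-- The value of a labelled vertex in terms of the values of its direct predecessors. -/
def CNode.eval {n : ℕ} {V : Type} (b : Fin n → Bool) :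
    (c : CNode n V) → ((u : V) → c.HasPred u → Bool) → Bool
  | .input i, _ => b i
  | .not u, r => !(r u rfl)
  | .or u v, r => r u (Or.inl rfl) || r v (Or.inr rfl)
  | .and u v, r => r u (Or.inl rfl) && r v (Or.inr rfl)

/-- The value of a vertex of a circuit on input `b`. -/
noncomputable def BoolCircuit.val {n : ℕ} (C : BoolCircuit n) (b : Fin n → Bool) :
    Fin C.size → Bool :=
  C.wellFounded.fix (fun v r => (C.node v).eval b r)

theorem BoolCircuit.val_eq {n : ℕ} (C : BoolCircuit n) (b : Fin n → Bool) (v : Fin C.size) :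
    C.val b v = (C.node v).eval b (fun u _ => C.val b u) :=
  C.wellFounded.fix_eq _ v

/-- The output of a circuit on input `b`. -/
noncomputable def BoolCircuit.output {n : ℕ} (C : BoolCircuit n) (b : Fin n → Bool) : Bool :=
  C.val b C.out

/-- The functions on strings that are computed by a circuit family whose `n`-th circuit has at
most `T n` vertices. A finite acyclic graph with a sink has a source, so there is no circuit with
`0` inputs, and circuit families are indexed by the positive natural numbers. -/
def SIZE (T : ℕ → ℕ) : Set (List Bool → Bool) :=
  {f | ∀ n : ℕ, 1 ≤ n → ∃ C : BoolCircuit n, C.size ≤ T n ∧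
    ∀ b : Fin n → Bool, C.output b = f (List.ofFn b)}

/-- The class P/poly: the functions on strings (characteristic functions of languages) that are
computed by circuit families of polynomial size. -/
def PPoly : Set (List Bool → Bool) := {f | ∃ T ∈ poly, f ∈ SIZE T}

end SinglePass

/-!
A circuit is simulated by a program that evaluates its vertices in topological order and keeps the
value of each vertex in an auxiliary register of its own.

Conversely, jumps only go forward, so an execution is determined by a single scan of the program
from left to right that remembers the register contents and the number of instructions still to be
skipped. Passing one instruction changes boundedly many of the Boolean signals that tell whether
the skip count is `q` and what register `r` contains, each at the cost of constantly many gates.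
The vertices that nobody reads are then absorbed into the output by `c ∨ (c ∧ v) = c`, because a
circuit has exactly one sink.
-/

namespace SinglePass

/-! ### Execution on Boolean registers -/

section Execution

variable {Φ M : Type*} {D : Set (Focus Φ)} {R : Focus Φ → Bool}

noncomputable instance : DecidableEq (Focus Φ) := Classical.decEq _

/-- The basic instruction `a` can be processed when exactly the registers named in `D` are
provided. -/
def BasicInstr.Enabled (D : Set (Focus Φ)) (a : BasicInstr Φ M) : Prop :=
  a.focus ∈ D ∧ ∀ m, a.meth ≠ .other m

/-- The reply to the basic instruction `a` when the registers have the contents `R`; it is only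
meaningful if `a` is enabled. -/
def BasicInstr.reply (a : BasicInstr Φ M) (R : Focus Φ → Bool) : Bool :=
  match a.meth with
  | .set c => c
  | _ => R a.focus

/-- The contents of the registers after processing the basic instruction `a`: both for `set` and
for `get`, the addressed register then contains the reply. -/
noncomputable def BasicInstr.write (a : BasicInstr Φ M) (R : Focus Φ → Bool) : Focus Φ → Bool :=
  Function.update R a.focus (a.reply R)

open Classical in
/-- The final contents of the output register when a thread is run with the registers named in `D`,
initially containing `R`; it is `none` if the thread does not terminate properly. -/
noncomputable def Thread.run (D : Set (Focus Φ)) : Thread Φ M → (Focus Φ → Bool) → Option Bool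
  | .deadEnd, _ => none
  | .terminated, R => some (R .out)
  | .tau x, R => x.run D R
  | .pcc x a y, R =>
    if a.Enabled D then
      if a.reply R then x.run D (a.write R) else y.run D (a.write R)
    else none

theorem BasicInstr.reply_br {a : BasicInstr Φ M} (ha : ∀ m, a.meth ≠ .other m) :
    (Service.br (R a.focus)).reply a.meth = .val (a.reply R) := by
  obtain ⟨f, _ | _ | m⟩ := a
  · rfl
  · rfl
  · exact absurd rfl (ha m)

theorem BasicInstr.derive_br {a : BasicInstr Φ M} (ha : ∀ m, a.meth ≠ .other m) :
    (Service.br (R a.focus)).derive a.meth = .br (a.write R a.focus) := by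
  obtain ⟨f, _ | _ | m⟩ := a
  · simp [Service.derive, BasicInstr.write, BasicInstr.reply]
  · simp [Service.derive, BasicInstr.write, BasicInstr.reply]
  · exact absurd rfl (ha m)

theorem apply_out_eq_run (p : Thread Φ M) (R : Focus Φ → Bool) :
    apply .out p (.br (R .out)) = (p.run {.out} R).elim .empty .br := by
  induction p generalizing R with
  | deadEnd => rfl
  | terminated => rfl
  | tau _ ih => exact ih R
  | pcc x a y ihx ihy =>
    by_cases hout : a.focus = .out
    · by_cases ha : ∀ m, a.meth ≠ .other m
      · have hreply := BasicInstr.reply_br (R := R) ha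
        have hderive := BasicInstr.derive_br (R := R) ha
        rw [hout] at hreply hderive
        cases h : a.reply R <;>
          simp [apply, Thread.run, BasicInstr.Enabled, hout, ha, hreply, hderive, h, ihx, ihy]
      · obtain ⟨m, hm⟩ := not_forall_not.1 ha
        simp [apply, Thread.run, BasicInstr.Enabled, hout, hm, Service.reply]
    · simp [apply, Thread.run, BasicInstr.Enabled, hout]

open scoped Classical in
theorem Thread.run_use {f : Focus Φ} (hf : f ≠ .out) (p : Thread Φ M) (c : Bool)
    (R : Focus Φ → Bool) :
    (use f p (.br c)).run D R = p.run (insert f D) (Function.update R f c) := by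
  induction p generalizing c R with
  | deadEnd => rfl
  | terminated => simp [use, Thread.run, hf.symm]
  | tau _ ih => exact ih c R
  | pcc x a y ihx ihy =>
    by_cases hfocus : a.focus = f
    · subst hfocus
      by_cases ha : ∀ m, a.meth ≠ .other m
      · have hreply := BasicInstr.reply_br (R := Function.update R a.focus c) ha
        have hderive := BasicInstr.derive_br (R := Function.update R a.focus c) ha
        rw [Function.update_self] at hreply hderive
        cases h : a.reply (Function.update R a.focus c) <;>
          simp [use, Thread.run, BasicInstr.Enabled, BasicInstr.write, ha, hreply, hderive, h,
            ihx, ihy]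
      · obtain ⟨m, hm⟩ := not_forall_not.1 ha
        simp [use, Thread.run, BasicInstr.Enabled, hm, Service.reply]
    · have henabled : a.Enabled (insert f D) ↔ a.Enabled D := by
        simp [BasicInstr.Enabled, hfocus]
      have hreply : a.reply (Function.update R f c) = a.reply R := by
        simp [BasicInstr.reply, hfocus]
      have hwrite : a.write (Function.update R f c) = Function.update (a.write R) f c := by
        rw [BasicInstr.write, BasicInstr.write, hreply, Function.update_comm (Ne.symm hfocus)]
      rw [Thread.run, if_congr henabled rfl rfl, hreply, hwrite, ← ihx, ← ihy]
      simp [use, Thread.run, hfocus]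

theorem Thread.run_foldl_use {α : Type*} (φ : α → Focus Φ) (hφ : ∀ i, φ i ≠ .out) (L : List α)
    (p : Thread Φ M) :
    (L.foldl (fun q i => use (φ i) q (.br (R (φ i)))) p).run D R =
      p.run (φ '' {i | i ∈ L} ∪ D) R := by
  induction L generalizing p with
  | nil => simp
  | cons i L ih =>
    rw [List.foldl_cons, ih, Thread.run_use (hφ i), Function.update_eq_self, ← Set.insert_union,
      ← Set.image_insert_eq]
    congr 3
    ext j
    simp

/-- The names of `n` input registers, `l` auxiliary registers and the output register. -/
def registers (Φ : Type*) (n l : ℕ) : Set (Focus Φ) :=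
  insert .out (.inp '' Set.Iio n ∪ .aux '' Set.Iio l)

/-- The contents of the registers at the start of a computation with input `b`. -/
def initRegs (Φ : Type*) {n : ℕ} (b : Fin n → Bool) : Focus Φ → Bool
  | .inp i => if h : i < n then b ⟨i, h⟩ else false
  | _ => false

theorem apply_out_useInp_useAux {n : ℕ} (p : Thread Φ M) (l : ℕ) (b : Fin n → Bool) :
    apply .out (useInp (useAux p l) b) (.br false) =
      (p.run (registers Φ n l) (initRegs Φ b)).elim .empty .br := by
  have haux : useAux p l =
      (List.range l).foldl (fun q j => use (.aux j) q (.br (initRegs Φ b (.aux j)))) p := rfl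
  have hinp (q : Thread Φ M) : useInp q b =
      (List.finRange n).foldl
        (fun q (i : Fin n) => use (.inp i) q (.br (initRegs Φ b (.inp i)))) q := by
    simp [useInp, initRegs]
  have hregisters : Focus.aux '' {j | j ∈ List.range l} ∪
      ((fun i : Fin n => Focus.inp i) '' {i | i ∈ List.finRange n} ∪ {.out}) =
        registers Φ n l := by
    ext x
    cases x <;> simp [registers, Fin.exists_iff]
  rw [← hregisters, ← Thread.run_foldl_use _ (by simp), ← haux,
    ← Thread.run_foldl_use _ (by simp), ← hinp]
  exact apply_out_eq_run _ (initRegs Φ b)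

theorem computes_iff {X : List (Instr Φ M)} {n : ℕ} {f : (Fin n → Bool) → Bool} :
    Computes X f ↔
      ∃ l, ∀ b, (extr X).run (registers Φ n l) (initRegs Φ b) = some (f b) := by
  have helim (o : Option Bool) (c : Bool) : o.elim Service.empty .br = .br c ↔ o = some c := by
    cases o <;> simp
  simp only [Computes, apply_out_useInp_useAux, helim]

theorem extr_jump_succ (l : ℕ) (X : List (Instr Φ M)) :
    extr (.jump (l + 1) :: X) = extr (X.drop l) := by
  induction l generalizing X with
  | zero => simp [extr]
  | succ l ih =>
    cases X with
    | nil => simp [extr]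
    | cons u X => rw [extr, ih, List.drop_succ_cons]

section Enabled

variable {a : BasicInstr Φ M}

theorem run_extr_plain (ha : a.Enabled D) (X : List (Instr Φ M)) :
    (extr (.plain a :: X)).run D R = (extr X).run D (a.write R) := by
  simp [extr, Thread.run, ha]

theorem run_extr_ptest (ha : a.Enabled D) (X : List (Instr Φ M)) :
    (extr (.ptest a :: X)).run D R =
      (extr (X.drop (if a.reply R then 0 else 1))).run D (a.write R) := by
  rw [extr, extr_jump_succ]
  cases h : a.reply R <;> simp [Thread.run, ha, h]

theorem run_extr_ntest (ha : a.Enabled D) (X : List (Instr Φ M)) :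
    (extr (.ntest a :: X)).run D R =
      (extr (X.drop (if a.reply R then 1 else 0))).run D (a.write R) := by
  rw [extr, extr_jump_succ]
  cases h : a.reply R <;> simp [Thread.run, ha, h]

end Enabled

end Execution

/-! ### From circuits to instruction sequences -/

section Simulation

variable {Φ M : Type*} {D : Set (Focus Φ)} {R R' R'' : Focus Φ → Bool} {n s : ℕ}
  {P Q : List (Instr Φ M)}

/-- Execution of the instruction sequence `P` with the registers named in `D`, initially containing
`R`, arrives right after `P` with the contents `R'`, whatever follows `P`. -/
def Traverses (D : Set (Focus Φ)) (P : List (Instr Φ M)) (R R' : Focus Φ → Bool) : Prop :=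
  ∀ X, (extr (P ++ X)).run D R = (extr X).run D R'

theorem Traverses.append (hP : Traverses D P R R') (hQ : Traverses D Q R' R'') :
    Traverses D (P ++ Q) R R'' := fun X => by
  rw [List.append_assoc, hP, hQ]

/-- Instructions that store the value of a vertex with the given label in the auxiliary register
`v`, provided that it contains false and that the auxiliary registers of the direct predecessors
contain their values. -/
def CNode.instrs (Φ M : Type*) (v : ℕ) : CNode n (Fin s) → List (Instr Φ M)
  | .input i => [.ptest ⟨.inp i, .get⟩, .plain ⟨.aux v, .set true⟩]
  | .not u => [.ntest ⟨.aux u, .get⟩, .plain ⟨.aux v, .set true⟩]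
  | .or u w => [.ptest ⟨.aux u, .get⟩, .plain ⟨.aux v, .set true⟩,
      .ptest ⟨.aux w, .get⟩, .plain ⟨.aux v, .set true⟩]
  | .and u w => [.ntest ⟨.aux u, .get⟩, .jump 3,
      .ptest ⟨.aux w, .get⟩, .plain ⟨.aux v, .set true⟩]

theorem CNode.isBr_of_mem_instrs {v : ℕ} {c : CNode n (Fin s)} :
    ∀ u ∈ c.instrs Φ M v, u.IsBr := by
  cases c <;> simp [CNode.instrs, Instr.IsBr, BasicInstr.IsBr]

theorem CNode.length_instrs_le (v : ℕ) (c : CNode n (Fin s)) :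
    (c.instrs Φ M v).length ≤ 4 := by
  cases c <;> simp [CNode.instrs]

theorem enabled_get_inp {i l : ℕ} (hi : i < n) :
    (⟨.inp i, .get⟩ : BasicInstr Φ M).Enabled (registers Φ n l) := by
  simp [BasicInstr.Enabled, registers, hi]

theorem enabled_get_aux {j l : ℕ} (hj : j < l) :
    (⟨.aux j, .get⟩ : BasicInstr Φ M).Enabled (registers Φ n l) := by
  simp [BasicInstr.Enabled, registers, hj]

theorem enabled_set_aux {j l : ℕ} (hj : j < l) (c : Bool) :
    (⟨.aux j, .set c⟩ : BasicInstr Φ M).Enabled (registers Φ n l) := by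
  simp [BasicInstr.Enabled, registers, hj]

theorem enabled_set_out (l : ℕ) (c : Bool) :
    (⟨.out, .set c⟩ : BasicInstr Φ M).Enabled (registers Φ n l) := by
  simp [BasicInstr.Enabled, registers]

theorem reply_get (x : Focus Φ) : (⟨x, .get⟩ : BasicInstr Φ M).reply R = R x := rfl

theorem write_get (x : Focus Φ) : (⟨x, .get⟩ : BasicInstr Φ M).write R = R :=
  Function.update_eq_self x R

theorem write_set (x : Focus Φ) (c : Bool) :
    (⟨x, .set c⟩ : BasicInstr Φ M).write R = Function.update R x c := rfl

theorem CNode.traverses_instrs {b : Fin n → Bool} {v : Fin s} (c : CNode n (Fin s))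
    (hinp : ∀ i : Fin n, R (.inp i) = b i) (hv : R (.aux v) = false)
    (hpred : ∀ u, c.HasPred u → u ≠ v) :
    Traverses (registers Φ n s) (c.instrs Φ M v) R
      (Function.update R (.aux v) (c.eval b fun u _ => R (.aux u))) := by
  intro X
  have hid : Function.update R (.aux v) false = R := by rw [← hv, Function.update_eq_self]
  have hset := enabled_set_aux (Φ := Φ) (M := M) (n := n) v.2 true
  have haux (u : Fin s) := enabled_get_aux (Φ := Φ) (M := M) (n := n) u.2
  cases c with
  | input i =>
    have hget := enabled_get_inp (Φ := Φ) (M := M) (l := s) i.2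
    cases h : b i <;>
      simp [CNode.instrs, CNode.eval, run_extr_ptest hget, run_extr_plain hset, reply_get,
        write_get, write_set, hinp, h, hid]
  | not u =>
    cases h : R (.aux u) <;>
      simp [CNode.instrs, CNode.eval, run_extr_ntest (haux u), run_extr_plain hset, reply_get,
        write_get, write_set, h, hid]
  | or u w =>
    have hw : (w : ℕ) ≠ v := fun e => hpred w (Or.inr rfl) (Fin.ext e)
    cases h : R (.aux u) <;> cases h' : R (.aux w) <;>
      simp [CNode.instrs, CNode.eval, run_extr_ptest (haux u), run_extr_ptest (haux w),
        run_extr_plain hset, reply_get, write_get, write_set, h, h', hid, hw]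
  | and u w =>
    cases h : R (.aux u) <;> cases h' : R (.aux w) <;>
      simp [CNode.instrs, CNode.eval, run_extr_ntest (haux u), run_extr_ptest (haux w),
        run_extr_plain hset, extr_jump_succ, reply_get, write_get, write_set, h, h', hid]

/-- The register contents `R` reached from the input `b` when exactly the vertices in `S` have been
evaluated: the auxiliary register `v` holds the value of the vertex `v` if `v ∈ S`. -/
structure BoolCircuit.Stores (C : BoolCircuit n) (b : Fin n → Bool) (S : Finset (Fin C.size))
    (R : Focus Φ → Bool) : Prop where
  inp : ∀ i : Fin n, R (.inp i) = b i
  aux : ∀ v : Fin C.size, R (.aux v) = (decide (v ∈ S) && C.val b v)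
  out : R .out = false

theorem BoolCircuit.stores_initRegs (C : BoolCircuit n) (b : Fin n → Bool) :
    C.Stores b ∅ (initRegs Φ b) where
  inp i := by simp [initRegs]
  aux v := by simp [initRegs]
  out := rfl

theorem BoolCircuit.Stores.insert {C : BoolCircuit n} {b : Fin n → Bool}
    {S : Finset (Fin C.size)} (h : C.Stores b S R) {v : Fin C.size}
    (hpred : ∀ u, (C.node v).HasPred u → u ∈ S) :
    C.Stores b (insert v S)
      (Function.update R (.aux v) ((C.node v).eval b fun u _ => R (.aux u))) where
  inp i := by simpa using h.inp i
  aux w := by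
    have hval : ((C.node v).eval b fun u _ => R (.aux u)) = C.val b v := by
      rw [C.val_eq]
      congr 1
      funext u hu
      simp [h.aux, hpred u hu]
    by_cases hw : w = v
    · simp [hw, hval]
    · simp [hw, h.aux, Fin.val_inj]
  out := by simpa using h.out

theorem finset_univ_induction_of_wellFounded {V : Type*} [Fintype V] [DecidableEq V]
    {r : V → V → Prop} (hr : WellFounded r) {p : Finset V → Prop} (empty : p ∅)
    (insert : ∀ (v : V) (S : Finset V), v ∉ S → (∀ u, r u v → u ∈ S) → p S → p (insert v S)) :
    p Finset.univ := by
  suffices h : ∀ k ≤ Fintype.card V, ∃ S : Finset V, S.card = k ∧ p S by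
    obtain ⟨S, hcard, hS⟩ := h _ le_rfl
    rwa [(Finset.card_eq_iff_eq_univ S).1 hcard] at hS
  intro k hk
  induction k with
  | zero => exact ⟨∅, rfl, empty⟩
  | succ k ih =>
    obtain ⟨S, hcard, hS⟩ := ih (by omega)
    obtain ⟨w, hw⟩ := Finset.exists_mem_notMem_of_card_lt_card
      (hcard.trans_lt (show k < Finset.univ.card by simpa using hk))
    obtain ⟨v, hv, hmin⟩ := hr.has_min {v | v ∉ S} ⟨w, hw.2⟩
    exact ⟨_, by rw [Finset.card_insert_of_notMem hv, hcard],
      insert v S hv (fun u hu => not_not.1 fun hmem => hmin u hmem hu) hS⟩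

theorem BoolCircuit.exists_traverses (Φ M : Type*) (C : BoolCircuit n) :
    ∃ P : List (Instr Φ M), (∀ u ∈ P, u.IsBr) ∧ P.length ≤ 4 * C.size ∧
      ∀ b, ∃ R, C.Stores b Finset.univ R ∧
        Traverses (registers Φ n C.size) P (initRegs Φ b) R := by
  let p (S : Finset (Fin C.size)) : Prop := ∃ P : List (Instr Φ M), (∀ u ∈ P, u.IsBr) ∧
    P.length ≤ 4 * S.card ∧
      ∀ b, ∃ R, C.Stores b S R ∧ Traverses (registers Φ n C.size) P (initRegs Φ b) R
  have empty : p ∅ := ⟨[], by simp, by simp, fun b => ⟨_, C.stores_initRegs b, fun _ => rfl⟩⟩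
  have huniv : p Finset.univ := by
    refine finset_univ_induction_of_wellFounded C.wellFounded empty ?_
    rintro v S hv hpred ⟨P, hP, hlength, hrun⟩
    refine ⟨P ++ (C.node v).instrs Φ M v,
      List.forall_mem_append.2 ⟨hP, CNode.isBr_of_mem_instrs⟩, ?_, fun b => ?_⟩
    · have := (C.node v).length_instrs_le (Φ := Φ) (M := M) v
      rw [List.length_append, Finset.card_insert_of_notMem hv]
      omega
    · obtain ⟨R, hR, htraverses⟩ := hrun b
      exact ⟨_, hR.insert hpred, htraverses.append <|
        (C.node v).traverses_instrs hR.inp (by simp [hR.aux, hv])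
          fun u hu huv => hv (huv ▸ hpred u hu)⟩
  simpa only [p, Finset.card_fin] using huniv

theorem BoolCircuit.exists_computes (Φ M : Type*) (C : BoolCircuit n) :
    ∃ X ∈ ISbr Φ M, Computes X C.output ∧ X.length ≤ 4 * C.size + 3 := by
  obtain ⟨P, hP, hlength, hrun⟩ := C.exists_traverses Φ M
  refine ⟨P ++ [.ptest ⟨.aux C.out, .get⟩, .plain ⟨.out, .set true⟩, .halt], ⟨by simp, ?_⟩,
    computes_iff.2 ⟨C.size, fun b => ?_⟩, by simpa using hlength⟩
  · exact List.forall_mem_append.2 ⟨hP, by simp [Instr.IsBr, BasicInstr.IsBr]⟩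
  · obtain ⟨R, hR, htraverses⟩ := hrun b
    have haux : R (.aux C.out) = C.output b := by simp [hR.aux, BoolCircuit.output]
    rw [htraverses, run_extr_ptest (enabled_get_aux C.out.2), reply_get, write_get, haux]
    cases C.output b
    · simp [extr, Thread.run, hR.out]
    · rw [if_pos rfl, List.drop_zero, run_extr_plain (enabled_set_out _ _)]
      simp [write_set, extr, Thread.run]

theorem exists_computes_zero (Φ M : Type*) (f : (Fin 0 → Bool) → Bool) :
    ∃ X ∈ ISbr Φ M, Computes X f ∧ X.length ≤ 2 := by
  refine ⟨[.plain ⟨.out, .set (f Fin.elim0)⟩, .halt], ⟨by simp, ?_⟩,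
    computes_iff.2 ⟨0, fun b => ?_⟩, by simp⟩
  · simp [Instr.IsBr, BasicInstr.IsBr]
  · rw [run_extr_plain (enabled_set_out _ _), write_set, Subsingleton.elim b Fin.elim0]
    simp [extr, Thread.run]

end Simulation

/-! ### From straight-line programs to circuits -/

section StraightLine

variable {n m : ℕ} {V W : Type}

/-- The label obtained from `c` by renaming the vertices at the tails of the incoming edges. -/
def CNode.map (φ : V → W) : CNode n V → CNode n W
  | .input i => .input i
  | .not u => .not (φ u)
  | .or u v => .or (φ u) (φ v)
  | .and u v => .and (φ u) (φ v)

theorem CNode.hasPred_map {φ : V → W} {c : CNode n V} {w : W} :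
    (c.map φ).HasPred w ↔ ∃ u, c.HasPred u ∧ φ u = w := by
  cases c <;> simp [CNode.map, CNode.HasPred, eq_comm, or_and_right, exists_or]

theorem CNode.map_eq_input {φ : V → W} {c : CNode n V} {i : Fin n} :
    c.map φ = .input i ↔ c = .input i := by
  cases c <;> simp [CNode.map]

theorem CNode.eval_map (b : Fin n → Bool) (φ : V → W) (c : CNode n V) (r : W → Bool) :
    ((c.map φ).eval b fun w _ => r w) = c.eval b fun u _ => r (φ u) := by
  cases c <;> rfl

/-- Straight-line programs, i.e. circuits whose vertices are numbered in a topological order and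
whose sinks are not restricted. Only the nodes with a number less than `size` belong to the
program. -/
structure StraightLine (n : ℕ) where
  size : ℕ
  node : ∀ v : ℕ, CNode n (Fin v)
  existsUnique_input : ∀ i : Fin n, ∃! v, v < size ∧ node v = .input i

namespace StraightLine

/-- The Boolean function that is computed at a node. -/
def val (P : StraightLine n) (v : ℕ) (b : Fin n → Bool) : Bool :=
  (P.node v).eval b fun u _ => P.val u b
termination_by v
decreasing_by exact u.2

variable (P : StraightLine n)

/-- There is an edge from the node `v` to the node `w`. -/
def Edge (v w : ℕ) : Prop := ∃ u, (P.node w).HasPred u ∧ (u : ℕ) = v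

/-- The node `v` is a sink. -/
def IsSink (v : ℕ) : Prop := v < P.size ∧ ∀ w < P.size, ¬ P.Edge v w

variable {P} in
theorem Edge.lt {v w : ℕ} (h : P.Edge v w) : v < w := by
  obtain ⟨u, -, rfl⟩ := h
  exact u.2

variable {P} in
/-- The circuit with the vertices of a straight-line program that has only one sink. -/
def toCircuit {out : ℕ} (hout : ∀ v, P.IsSink v ↔ v = out) : BoolCircuit n where
  size := P.size
  node v := (P.node v).map (Fin.castLE v.2.le)
  acyclic v hv := by
    have hlt : (fun u w : Fin P.size => ((P.node w).map (Fin.castLE w.2.le)).HasPred u) ≤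
        (· < ·) := by
      intro u w h
      obtain ⟨x, -, rfl⟩ := CNode.hasPred_map.1 h
      exact x.2
    exact lt_irrefl v (Relation.transGen_minimal hlt v v hv)
  exists_unique_input i := by
    obtain ⟨v, ⟨hv, hnode⟩, hunique⟩ := P.existsUnique_input i
    exact ⟨⟨v, hv⟩, CNode.map_eq_input.2 hnode,
      fun w hw => Fin.ext (hunique w ⟨w.2, CNode.map_eq_input.1 hw⟩)⟩
  out := ⟨out, ((hout out).2 rfl).1⟩
  sink_iff v := by
    rw [Fin.ext_iff, ← hout]
    simp [IsSink, Edge, CNode.hasPred_map, Fin.ext_iff, Fin.forall_iff]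

theorem output_toCircuit {out : ℕ} (hout : ∀ v, P.IsSink v ↔ v = out) :
    (toCircuit hout).output = P.val out := by
  funext b
  suffices h : ∀ v (hv : v < P.size), (toCircuit hout).val b ⟨v, hv⟩ = P.val v b from h _ _
  intro v
  induction v using Nat.strong_induction_on with
  | _ v ih =>
    intro hv
    rw [BoolCircuit.val_eq, val]
    refine (CNode.eval_map b _ _ _).trans ?_
    congr 1
    funext u _
    exact ih u u.2 (u.2.trans hv)

/-- The straight-line program `P` extended with the gate `c`. -/
def snoc (c : CNode n (Fin P.size)) (hc : ∀ i, c ≠ .input i) : StraightLine n where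
  size := P.size + 1
  node := Function.update P.node P.size c
  existsUnique_input i := by
    convert P.existsUnique_input i using 2 with v
    rcases eq_or_ne v P.size with rfl | hv
    · simp [hc]
    · simp [hv, Order.lt_add_one_iff, hv.le_iff_lt]

section Snoc

variable {P} (c : CNode n (Fin P.size)) (hc : ∀ i, c ≠ .input i)

theorem val_snoc_of_lt {v : ℕ} (hv : v < P.size) : (P.snoc c hc).val v = P.val v := by
  induction v using Nat.strong_induction_on with
  | _ v ih =>
    funext b
    have hnode : (P.snoc c hc).node v = P.node v := Function.update_of_ne hv.ne _ _
    rw [val, val, hnode]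
    congr 1
    funext u _
    rw [ih u u.2 (u.2.trans hv)]

theorem val_snoc_size :
    (P.snoc c hc).val P.size = fun b => c.eval b fun u _ => P.val u b := by
  funext b
  have hnode : (P.snoc c hc).node P.size = c := Function.update_self _ _ _
  rw [val, hnode]
  congr 1
  funext u _
  rw [val_snoc_of_lt c hc u.2]

theorem isSink_snoc {v : ℕ} :
    (P.snoc c hc).IsSink v ↔
      v = P.size ∨ P.IsSink v ∧ ¬ ∃ u : Fin P.size, c.HasPred u ∧ (u : ℕ) = v := by
  have hsize : (P.snoc c hc).size = P.size + 1 := rfl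
  have hedge_size : (P.snoc c hc).Edge v P.size ↔ ∃ u : Fin P.size, c.HasPred u ∧ (u : ℕ) = v := by
    simp [Edge, snoc]
  have hedge {w : ℕ} (hw : w < P.size) : (P.snoc c hc).Edge v w ↔ P.Edge v w := by
    simp [Edge, snoc, hw.ne]
  simp only [IsSink, hsize, Nat.lt_succ_iff_lt_or_eq, or_imp, forall_and, forall_eq, hedge_size]
  constructor
  · rintro ⟨hv | hv, hold, hnew⟩
    · exact .inr ⟨⟨hv, fun w hw h => hold w hw ((hedge hw).2 h)⟩, hnew⟩
    · exact .inl hv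
  · rintro (rfl | ⟨⟨hv, hold⟩, hnew⟩)
    · exact ⟨.inr rfl, fun w hw h => hw.not_gt h.lt, fun ⟨u, _, hu⟩ => u.2.ne hu⟩
    · exact ⟨.inl hv, fun w hw h => hold w hw ((hedge hw).1 h), hnew⟩

end Snoc

/-- Absorption: `c ∨ (c ∧ v) = c`. -/
theorem exists_absorb {c v : ℕ} (hc : c < P.size) (hv : v < P.size) :
    ∃ Q : StraightLine n, Q.size = P.size + 2 ∧ Q.val (P.size + 1) = P.val c ∧
      ∀ w, Q.IsSink w ↔ w = P.size + 1 ∨ P.IsSink w ∧ w ≠ c ∧ w ≠ v := by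
  let P' := P.snoc (.and ⟨c, hc⟩ ⟨v, hv⟩) (by simp)
  have hP' : P'.size = P.size + 1 := rfl
  refine ⟨P'.snoc (.or ⟨c, by omega⟩ ⟨P.size, by omega⟩) (by simp), rfl, ?_, fun w => ?_⟩
  · rw [← hP', val_snoc_size]
    funext b
    simp only [CNode.eval, P', val_snoc_of_lt _ _ hc, val_snoc_size]
    cases P.val c b <;> simp
  · have hpred {k x y : ℕ} (hx : x < k) (hy : y < k) :
        (∃ u : Fin k, (u = ⟨x, hx⟩ ∨ u = ⟨y, hy⟩) ∧ (u : ℕ) = w) ↔ w = x ∨ w = y := by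
      simp [or_and_right, exists_or, eq_comm]
    have hand : P'.IsSink w ↔ w = P.size ∨ P.IsSink w ∧ ¬(w = c ∨ w = v) := by
      simp only [P', isSink_snoc, CNode.HasPred, hpred]
    have hlt : P.IsSink w → w < P.size := And.left
    rw [isSink_snoc, hand]
    simp only [CNode.HasPred, hpred]
    grind

theorem exists_circuit_of_sinks {c : ℕ} (hc : P.IsSink c) (U : Finset ℕ)
    (hU : ∀ v ∈ U, v < P.size) (hsinks : ∀ v, P.IsSink v → v = c ∨ v ∈ U) :
    ∃ C : BoolCircuit n, C.size = P.size + 2 * U.card ∧ C.output = P.val c := by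
  induction U using Finset.induction_on generalizing P c with
  | empty =>
    have hunique (v : ℕ) : P.IsSink v ↔ v = c :=
      ⟨fun hv => by simpa using hsinks v hv, fun hv => hv ▸ hc⟩
    exact ⟨toCircuit hunique, rfl, P.output_toCircuit hunique⟩
  | insert v U hvU ih =>
    obtain ⟨Q, hsize, hval, hsink⟩ := P.exists_absorb hc.1 (hU v (Finset.mem_insert_self v U))
    obtain ⟨C, hC, houtput⟩ := ih Q ((hsink _).2 (.inl rfl))
      (fun w hw => by have := hU w (Finset.mem_insert_of_mem hw); omega)
      (fun w hw => ((hsink w).1 hw).imp_right fun ⟨hw, hwc, hwv⟩ =>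
        (Finset.mem_insert.1 ((hsinks w hw).resolve_left hwc)).resolve_left hwv)
    refine ⟨C, ?_, houtput.trans hval⟩
    rw [hC, hsize, Finset.card_insert_of_notMem hvU]
    ring

theorem exists_circuit {v : ℕ} (hv : v < P.size) :
    ∃ C : BoolCircuit n, C.size = 3 * P.size + 1 ∧ C.output = P.val v := by
  -- The node `v` need not be a sink, but the appended node `v ∧ v` is one.
  let Q := P.snoc (.and ⟨v, hv⟩ ⟨v, hv⟩) (by simp)
  obtain ⟨C, hC, houtput⟩ := Q.exists_circuit_of_sinks
    ((isSink_snoc _ _).2 (.inl rfl)) (Finset.range P.size)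
    (fun u hu => (Finset.mem_range.1 hu).trans (Nat.lt_succ_self _))
    (fun u hu => ((isSink_snoc _ _).1 hu).imp_right fun h => Finset.mem_range.2 h.1.1)
  refine ⟨C, ?_, ?_⟩
  · rw [hC, Finset.card_range, show Q.size = P.size + 1 from rfl]
    ring
  · rw [houtput, val_snoc_size]
    simp [CNode.eval]

end StraightLine

/-- Some straight-line program with at most `m` nodes computes all Boolean functions in `S`. -/
def Generates (m : ℕ) (S : Set ((Fin n → Bool) → Bool)) : Prop :=
  ∃ P : StraightLine n, P.size ≤ m ∧ S ⊆ P.val '' Set.Iio P.size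

namespace Generates

variable {m' : ℕ} {S S' : Set ((Fin n → Bool) → Bool)} {f g : (Fin n → Bool) → Bool}

theorem mono (h : Generates m S) (hm : m ≤ m') (hS : S' ⊆ S) : Generates m' S' := by
  obtain ⟨P, hsize, hP⟩ := h
  exact ⟨P, hsize.trans hm, hS.trans hP⟩

theorem exists_circuit (h : Generates m S) (hf : f ∈ S) :
    ∃ C : BoolCircuit n, C.size ≤ 3 * m + 1 ∧ C.output = f := by
  obtain ⟨P, hsize, hP⟩ := h
  obtain ⟨v, hv, rfl⟩ := hP hf
  obtain ⟨C, hC, houtput⟩ := P.exists_circuit hv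
  exact ⟨C, by omega, houtput⟩

theorem range_eval [NeZero n] : Generates n (Set.range fun (i : Fin n) b => b i) := by
  let P : StraightLine n :=
    { size := n
      node := fun v => .input (Fin.ofNat n v)
      existsUnique_input := fun i => ⟨i, by simp, fun v ⟨hv, h⟩ => by
        have := congrArg Fin.val (CNode.input.inj h)
        simpa [Nat.mod_eq_of_lt hv] using this⟩ }
  refine ⟨P, le_rfl, ?_⟩
  rintro _ ⟨i, rfl⟩
  refine ⟨i, i.2, ?_⟩
  funext b
  simp [StraightLine.val, P, CNode.eval]

theorem insert_eval {P : StraightLine n} (c : CNode n (Fin P.size)) (hc : ∀ i, c ≠ .input i) :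
    Generates (P.size + 1)
      (insert (fun b => c.eval b fun u _ => P.val u b) (P.val '' Set.Iio P.size)) := by
  refine ⟨P.snoc c hc, le_rfl, Set.insert_subset ?_ ?_⟩
  · exact ⟨P.size, Nat.lt_succ_self _, StraightLine.val_snoc_size c hc⟩
  · rintro _ ⟨v, hv, rfl⟩
    exact ⟨v, Nat.lt_succ_of_lt hv, StraightLine.val_snoc_of_lt c hc hv⟩

theorem insert_not (h : Generates m S) (hf : f ∈ S) :
    Generates (m + 1) (insert (fun b => !f b) S) := by
  obtain ⟨P, hsize, hP⟩ := h
  obtain ⟨v, hv, rfl⟩ := hP hf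
  exact (insert_eval (.not ⟨v, hv⟩) (by simp)).mono (by omega) (Set.insert_subset_insert hP)

theorem insert_or (h : Generates m S) (hf : f ∈ S) (hg : g ∈ S) :
    Generates (m + 1) (insert (fun b => f b || g b) S) := by
  obtain ⟨P, hsize, hP⟩ := h
  obtain ⟨v, hv, rfl⟩ := hP hf
  obtain ⟨w, hw, rfl⟩ := hP hg
  exact (insert_eval (.or ⟨v, hv⟩ ⟨w, hw⟩) (by simp)).mono (by omega)
    (Set.insert_subset_insert hP)

theorem insert_and (h : Generates m S) (hf : f ∈ S) (hg : g ∈ S) :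
    Generates (m + 1) (insert (fun b => f b && g b) S) := by
  obtain ⟨P, hsize, hP⟩ := h
  obtain ⟨v, hv, rfl⟩ := hP hf
  obtain ⟨w, hw, rfl⟩ := hP hg
  exact (insert_eval (.and ⟨v, hv⟩ ⟨w, hw⟩) (by simp)).mono (by omega)
    (Set.insert_subset_insert hP)

end Generates

/-- The Boolean-valued function `f` can be obtained from the functions in `S` by at most `k`
negations, disjunctions and conjunctions. -/
inductive FormulaOver {α : Type*} (S : Set (α → Bool)) : ℕ → (α → Bool) → Prop
  | of_mem {k : ℕ} {f : α → Bool} (hf : f ∈ S) : FormulaOver S k f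
  | not {k : ℕ} {f : α → Bool} (hf : FormulaOver S k f) : FormulaOver S (k + 1) fun a => !f a
  | or {k l : ℕ} {f g : α → Bool} (hf : FormulaOver S k f) (hg : FormulaOver S l g) :
      FormulaOver S (k + l + 1) fun a => f a || g a
  | and {k l : ℕ} {f g : α → Bool} (hf : FormulaOver S k f) (hg : FormulaOver S l g) :
      FormulaOver S (k + l + 1) fun a => f a && g a

namespace FormulaOver

variable {α β : Type*} {S : Set (α → Bool)} {k : ℕ} {f : α → Bool}

theorem comp (hf : FormulaOver S k f) (s : β → α) :
    FormulaOver ((· ∘ s) '' S) k (f ∘ s) := by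
  induction hf with
  | of_mem hf => exact .of_mem ⟨_, hf, rfl⟩
  | not _ ih => exact ih.not
  | or _ _ ihf ihg => exact ihf.or ihg
  | and _ _ ihf ihg => exact ihf.and ihg

theorem boolFun_comp (hconst : ∀ c, (fun _ => c) ∈ S) (hf : f ∈ S) (φ : Bool → Bool) :
    FormulaOver S 1 fun a => φ (f a) := by
  rcases ht : φ true with _ | _ <;> rcases hff : φ false with _ | _
  · convert of_mem (hconst false) using 2 with a
    cases f a <;> assumption
  · convert (of_mem (k := 0) hf).not using 2 with a
    cases f a <;> assumption
  · convert of_mem hf using 2 with a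
    cases f a <;> assumption
  · convert of_mem (hconst true) using 2 with a
    cases f a <;> assumption

theorem generates_insert {S T : Set ((Fin n → Bool) → Bool)} {f : (Fin n → Bool) → Bool}
    (hf : FormulaOver S k f) (hST : S ⊆ T) (hT : Generates m T) :
    Generates (m + k) (insert f T) := by
  induction hf generalizing m T with
  | of_mem hf => exact hT.mono (by omega) (by simp [hST hf])
  | not _ ih =>
    exact ((ih hST hT).insert_not (Set.mem_insert _ _)).mono (by omega)
      (Set.insert_subset_insert (Set.subset_insert _ _))
  | or _ _ ihf ihg =>
    have hfg := ihg (hST.trans (Set.subset_insert _ _)) (ihf hST hT)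
    exact (hfg.insert_or (by simp) (Set.mem_insert _ _)).mono (by omega)
      (Set.insert_subset_insert ((Set.subset_insert _ _).trans (Set.subset_insert _ _)))
  | and _ _ ihf ihg =>
    have hfg := ihg (hST.trans (Set.subset_insert _ _)) (ihf hST hT)
    exact (hfg.insert_and (by simp) (Set.mem_insert _ _)).mono (by omega)
      (Set.insert_subset_insert ((Set.subset_insert _ _).trans (Set.subset_insert _ _)))

end FormulaOver

end StraightLine

/-! ### From instruction sequences to straight-line programs -/

section Scan

variable {Φ M : Type*} {D : Set (Focus Φ)} {R : Focus Φ → Bool} {n m : ℕ}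

namespace Instr

/-- The basic instruction contained in a primitive instruction. -/
def basic : Instr Φ M → Option (BasicInstr Φ M)
  | .plain a | .ptest a | .ntest a => some a
  | .jump _ | .halt => none

/-- The number of instructions that are skipped after processing the instruction `u` when the reply
is `c`; it is `none` if execution ends. -/
def next : Instr Φ M → Bool → Option ℕ
  | .plain _, _ => some 0
  | .ptest _, c => some (if c then 0 else 1)
  | .ntest _, c => some (if c then 1 else 0)
  | .jump l, _ => if l = 0 then none else some (l - 1)
  | .halt, _ => none

/-- The reply on processing the instruction `u`; it is irrelevant for jumps and termination. -/
def reply (u : Instr Φ M) (R : Focus Φ → Bool) : Bool :=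
  u.basic.elim false fun a => a.reply R

/-- The contents of the registers after processing the instruction `u`. -/
noncomputable def write (u : Instr Φ M) (R : Focus Φ → Bool) : Focus Φ → Bool :=
  u.basic.elim R fun a => a.write R

end Instr

theorem run_extr_cons_eq_some {u : Instr Φ M} {X : List (Instr Φ M)} {r : Bool}
    (h : (extr (u :: X)).run D R = some r) :
    (u.next (u.reply R)).elim (some (u.write R .out))
      (fun k => (extr (X.drop k)).run D (u.write R)) = some r := by
  have henabled {a : BasicInstr Φ M} {x y : Thread Φ M} (h : (x.pcc a y).run D R = some r) :
      a.Enabled D := by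
    by_contra ha
    simp [Thread.run, ha] at h
  cases u with
  | plain a =>
    rwa [run_extr_plain (henabled (by rwa [extr] at h))] at h
  | ptest a =>
    rwa [run_extr_ptest (henabled (by rwa [extr] at h))] at h
  | ntest a =>
    rwa [run_extr_ntest (henabled (by rwa [extr] at h))] at h
  | jump l =>
    cases l with
    | zero => simp [extr, Thread.run] at h
    | succ l => rwa [extr_jump_succ] at h
  | halt => rwa [extr] at h

/-- The state of a scan of an instruction sequence from left to right: the number of instructions
that are skipped before the next one is processed, which is `none` once execution has ended, and the
contents of the registers. -/
structure ScanState (Φ : Type*) where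
  skip : Option ℕ
  regs : Focus Φ → Bool

/-- The effect of passing one instruction in a scan. -/
noncomputable def Instr.pass (u : Instr Φ M) (s : ScanState Φ) : ScanState Φ :=
  match s.skip with
  | none => s
  | some 0 => ⟨u.next (u.reply s.regs), u.write s.regs⟩
  | some (q + 1) => ⟨some q, s.regs⟩

/-- The effect of scanning an instruction sequence. -/
noncomputable def scan (X : List (Instr Φ M)) (s : ScanState Φ) : ScanState Φ :=
  X.foldl (fun t u => u.pass t) s

theorem scan_cons (u : Instr Φ M) (X : List (Instr Φ M)) (s : ScanState Φ) :
    scan (u :: X) s = scan X (u.pass s) := rfl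

theorem scan_skip_none (X : List (Instr Φ M)) (R : Focus Φ → Bool) :
    scan X ⟨none, R⟩ = ⟨none, R⟩ := by
  induction X with
  | nil => rfl
  | cons _ _ ih => exact ih

theorem scan_out_of_run_eq_some {X : List (Instr Φ M)} {k : ℕ} {r : Bool}
    (h : (extr (X.drop k)).run D R = some r) : (scan X ⟨some k, R⟩).regs .out = r := by
  induction X generalizing k R with
  | nil => simp [extr, Thread.run] at h
  | cons u X ih =>
    cases k with
    | succ k => exact ih h
    | zero =>
      have hnext := run_extr_cons_eq_some h
      rw [scan_cons, Instr.pass]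
      cases hskip : u.next (u.reply R) with
      | none => simpa [hskip, scan_skip_none] using hnext
      | some k => exact ih (by simpa [hskip] using hnext)

/-- The Boolean observables of the state of a scan: the constants, whether a given number of
instructions remains to be skipped, and the contents of the registers. -/
def observables (Φ : Type*) : Set (ScanState Φ → Bool) :=
  (Set.range fun c _ => c) ∪ (Set.range fun q s => s.skip == some q) ∪
    Set.range fun x s => s.regs x

theorem const_mem_observables (c : Bool) : (fun _ => c) ∈ observables Φ := .inl (.inl ⟨c, rfl⟩)

theorem skip_mem_observables (q : ℕ) : (fun s => s.skip == some q) ∈ observables Φ :=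
  .inl (.inr ⟨q, rfl⟩)

theorem regs_mem_observables (x : Focus Φ) : (fun s => s.regs x) ∈ observables Φ := .inr ⟨x, rfl⟩

theorem BasicInstr.reply_mem_observables (a : BasicInstr Φ M) :
    (fun s => a.reply s.regs) ∈ observables Φ := by
  obtain ⟨x, c | _ | _⟩ := a
  · exact const_mem_observables c
  · exact regs_mem_observables x
  · exact regs_mem_observables x

namespace Instr

variable (u : Instr Φ M)

theorem reply_mem_observables : (fun s => u.reply s.regs) ∈ observables Φ := by
  unfold reply
  cases u.basic with
  | none => exact const_mem_observables false
  | some a => exact a.reply_mem_observables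

theorem exists_write_mem_observables :
    ∃ x, (fun s => u.write s.regs x) ∈ observables Φ ∧ ∀ y ≠ x, ∀ R, u.write R y = R y := by
  unfold write
  cases u.basic with
  | none => exact ⟨.out, regs_mem_observables _, fun _ _ _ => rfl⟩
  | some a =>
    refine ⟨a.focus, ?_, fun y hy R => Function.update_of_ne hy _ _⟩
    simpa [BasicInstr.write] using a.reply_mem_observables

theorem skip_pass (s : ScanState Φ) (q : ℕ) :
    ((u.pass s).skip == some q) =
      ((s.skip == some (q + 1)) || (s.skip == some 0) && (u.next (u.reply s.regs) == some q)) := by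
  obtain ⟨_ | _ | k, R⟩ := s <;> simp [pass]

theorem regs_pass (s : ScanState Φ) (x : Focus Φ) :
    (u.pass s).regs x =
      ((s.skip == some 0) && u.write s.regs x || !(s.skip == some 0) && s.regs x) := by
  obtain ⟨_ | _ | k, R⟩ := s <;> simp [pass]

theorem formulaOver_skip_pass (q : ℕ) :
    FormulaOver (observables Φ) 3 fun s => (u.pass s).skip == some q := by
  have hnext := FormulaOver.boolFun_comp const_mem_observables u.reply_mem_observables
    fun c => u.next c == some q
  have hskip (k : ℕ) : FormulaOver (observables Φ) 0 fun s => s.skip == some k :=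
    .of_mem (skip_mem_observables k)
  simpa only [skip_pass] using (hskip (q + 1)).or ((hskip 0).and hnext)

theorem formulaOver_regs_pass {x : Focus Φ} (hx : (fun s => u.write s.regs x) ∈ observables Φ) :
    FormulaOver (observables Φ) 4 fun s => (u.pass s).regs x := by
  have hwrite : FormulaOver (observables Φ) 0 fun s => u.write s.regs x := .of_mem hx
  have hregs : FormulaOver (observables Φ) 0 fun s => s.regs x :=
    .of_mem (regs_mem_observables x)
  have hskip : FormulaOver (observables Φ) 0 fun s => s.skip == some 0 :=
    .of_mem (skip_mem_observables 0)
  simpa only [regs_pass] using (hskip.and hwrite).or (hskip.not.and hregs)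

/-- After `u`, only the two skip counts that `u` itself can produce depend on the reply, and `u`
writes to at most one register. -/
theorem exists_formulas_pass :
    ∃ f g h, FormulaOver (observables Φ) 3 f ∧ FormulaOver (observables Φ) 3 g ∧
      FormulaOver (observables Φ) 4 h ∧
        ∀ o ∈ observables Φ, o ∘ u.pass ∈ insert h (insert g (insert f (observables Φ))) := by
  obtain ⟨x, hx, hother⟩ := u.exists_write_mem_observables
  refine ⟨_, _, _, u.formulaOver_skip_pass ((u.next true).getD 0),
    u.formulaOver_skip_pass ((u.next false).getD 0), u.formulaOver_regs_pass hx, ?_⟩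
  rintro _ ((⟨c, rfl⟩ | ⟨q, rfl⟩) | ⟨y, rfl⟩)
  · exact .inr (.inr (.inr (const_mem_observables c)))
  · by_cases htrue : u.next true = some q
    · exact .inr (.inr (.inl (by simp [htrue, Function.comp_def])))
    by_cases hfalse : u.next false = some q
    · exact .inr (.inl (by simp [hfalse, Function.comp_def]))
    have hnext (c : Bool) : (u.next c == some q) = false := by cases c <;> simpa
    refine .inr (.inr (.inr ?_))
    simpa [Function.comp_def, skip_pass, hnext] using skip_mem_observables (q + 1)
  · by_cases hy : y = x
    · exact .inl (hy ▸ rfl)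
    have hregs (s : ScanState Φ) : (u.pass s).regs y = s.regs y := by
      rw [regs_pass, hother y hy]
      cases s.skip == some 0 <;> simp
    refine .inr (.inr (.inr ?_))
    simpa only [Function.comp_def, hregs] using regs_mem_observables y

end Instr

/-- The observables of a state that depends on the input, as Boolean functions of the input. -/
def signals (s : (Fin n → Bool) → ScanState Φ) : Set ((Fin n → Bool) → Bool) :=
  (· ∘ s) '' observables Φ

theorem generates_signals_pass {s : (Fin n → Bool) → ScanState Φ} (h : Generates m (signals s))
    (u : Instr Φ M) : Generates (m + 10) (signals (u.pass ∘ s)) := by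
  obtain ⟨f, g, k, hf, hg, hk, hpass⟩ := u.exists_formulas_pass
  have hf' := (hf.comp s).generates_insert subset_rfl h
  have hg' := (hg.comp s).generates_insert (Set.subset_insert _ _) hf'
  have hk' := (hk.comp s).generates_insert
    ((Set.subset_insert _ _).trans (Set.subset_insert _ _)) hg'
  refine hk'.mono le_rfl ?_
  rintro _ ⟨o, ho, rfl⟩
  simpa only [signals, Set.image_insert_eq, Function.comp_assoc] using
    Set.mem_image_of_mem (· ∘ s) (hpass o ho)

theorem generates_signals_scan {s : (Fin n → Bool) → ScanState Φ} (h : Generates m (signals s))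
    (X : List (Instr Φ M)) : Generates (m + 10 * X.length) (signals (scan X ∘ s)) := by
  induction X generalizing m s with
  | nil => exact h
  | cons u X ih => exact (ih (generates_signals_pass h u)).mono (by grind) subset_rfl

theorem generates_signals_init (Φ : Type*) [NeZero n] :
    Generates (n + 4) (signals fun b : Fin n → Bool => ⟨some 0, initRegs Φ b⟩) := by
  let S : Set ((Fin n → Bool) → Bool) := Set.range fun i b => b i
  have hvar : FormulaOver S 0 fun b => b 0 := .of_mem ⟨0, rfl⟩
  have hfalse : FormulaOver S 2 fun _ => false := by simpa using hvar.and hvar.not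
  have htrue : FormulaOver S 2 fun _ => true := by simpa using hvar.or hvar.not
  have hgenerates := htrue.generates_insert (Set.subset_insert _ _)
    (hfalse.generates_insert subset_rfl Generates.range_eval)
  have hconst (c : Bool) : (fun _ => c) ∈ insert (fun _ => true) (insert (fun _ => false) S) := by
    cases c <;> simp
  refine hgenerates.mono le_rfl ?_
  rintro _ ⟨_, (⟨c, rfl⟩ | ⟨q, rfl⟩) | ⟨x, rfl⟩, rfl⟩
  · exact hconst c
  · exact hconst (some 0 == some q)
  · rcases x with i | _ | _ | _
    · by_cases hi : i < n
      · exact .inr (.inr ⟨⟨i, hi⟩, by simp [Function.comp_def, initRegs, hi]⟩)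
      · simp [Function.comp_def, initRegs, hi]
    all_goals exact hconst false

theorem Computes.exists_circuit [NeZero n] {X : List (Instr Φ M)} {f : (Fin n → Bool) → Bool}
    (h : Computes X f) :
    ∃ C : BoolCircuit n, C.size ≤ 3 * (n + 4 + 10 * X.length) + 1 ∧ C.output = f := by
  obtain ⟨l, hrun⟩ := computes_iff.1 h
  refine (generates_signals_scan (generates_signals_init Φ) X).exists_circuit
    ⟨_, regs_mem_observables .out, ?_⟩
  funext b
  exact scan_out_of_run_eq_some (k := 0) (hrun b)

end Scan

theorem familyEquiv_mem_PPoly {Φ M : Type*} {f : BoolFunFamily} (hf : f ∈ PLIS Φ M) :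
    familyEquiv f ∈ PPoly := by
  obtain ⟨h, ⟨p, hp⟩, hX⟩ := hf
  refine ⟨fun n => 3 * (n + 4 + 10 * h n) + 1,
    ⟨3 * (.X + 4 + 10 * p) + 1, fun n => by simp [hp]⟩, fun n hn => ?_⟩
  have : NeZero n := ⟨by omega⟩
  obtain ⟨X, -, hcomputes, hlength⟩ := hX n
  obtain ⟨C, hsize, houtput⟩ := hcomputes.exists_circuit
  refine ⟨C, by dsimp only; omega, fun b => ?_⟩
  rw [houtput]
  exact congrFun (congrFun (familyEquiv.symm_apply_apply f).symm n) b

theorem familyEquiv_symm_mem_PLIS (Φ M : Type*) {g : List Bool → Bool} (hg : g ∈ PPoly) :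
    familyEquiv.symm g ∈ PLIS Φ M := by
  obtain ⟨T, ⟨p, hp⟩, hC⟩ := hg
  refine ⟨fun n => 4 * T n + 3, ⟨4 * p + 3, fun n => by simp [hp]⟩, fun n => ?_⟩
  rcases n.eq_zero_or_pos with rfl | hn
  · obtain ⟨X, hX, hcomputes, hlength⟩ := exists_computes_zero Φ M (familyEquiv.symm g 0)
    exact ⟨X, hX, hcomputes, by dsimp only; omega⟩
  · obtain ⟨C, hsize, houtput⟩ := hC n hn
    obtain ⟨X, hX, hcomputes, hlength⟩ := C.exists_computes Φ M
    rw [show C.output = familyEquiv.symm g n from funext houtput] at hcomputes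
    exact ⟨X, hX, hcomputes, by dsimp only; omega⟩

end SinglePass

theorem mainTheorem1 (Φ M : Type*) :
    SinglePass.familyEquiv '' SinglePass.PLIS Φ M = SinglePass.PPoly := by
  refine Set.Subset.antisymm ?_ fun g hg => ?_
  · rintro _ ⟨f, hf, rfl⟩
    exact SinglePass.familyEquiv_mem_PPoly hf
  · exact ⟨_, SinglePass.familyEquiv_symm_mem_PLIS Φ M hg,
      SinglePass.familyEquiv.apply_symm_apply g⟩
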